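/- **Setting.** Fix $n,m\in\mathbb N$, a total quantity $q>0$ and a comparison factor $\alpha>0$. A request sequence $E=((N_t,q_t))_{t\in[m]}$ consists of non-empty sets $N_t\subseteq[n]$ of compatible offline nodes and quantities $q_t>0$; let $\mathcal E_{n,m,q}$ be the set of those with $\sum_t q_t=q$. Let $\Delta(N_t,q_t)$ be the set of feasible allocations of node $t$, i.e. of $x\in\mathbb R^n_{\ge0}$ with $x(i)=0$ for $i\notin N_t$ and $\sum_i x(i)=q_t$, and let $\Delta(E)=\sum_{t}\Delta(N_t,q_t)$ (Minkowski sum) be the set of feasible load vectors. A deterministic policy maps the history of past requests and allocations together with the current request $(N_t,q_t)$ to an allocation $x_t\in\Delta(N_t,q_t)$. A randomized policy $\mathcal A$ is a random choice of such a policy, made independently of $E$, for which the resulting load vector $\mathcal A(E)=\sum_{t}x_t$ is a random vector for every fixed request sequence $E$. Water-filling ($\mathrm{WF}$) is the deterministic policy which, given the current loads $\ell_{t-1}=\sum_{s<t}x_s$, picks the (unique) $x_t\in\Delta(N_t,q_t)$ maximizing $\min_{i\in N_t}\{x_t(i)+\ell_{t-1}(i)\}$. For an objective $f:\mathbb R^n_{\ge0}\to\mathbb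 R_{\ge0}$ to be maximized, or $g:\mathbb R^n_{\ge0}\to\mathbb R_{\ge0}$ to be minimized, the worst-case $\alpha$-regret of $\mathcal A$ against an oblivious adversary is $$\mathrm{Reg}^{\max}_{(n,m,q),\alpha,f}(\mathcal A)=\sup_{E\in\mathcal E_{n,m,q}}\Big(\alpha\max_{\ell\in\Delta(E)}f(\ell)-\mathbb E[f(\mathcal A(E))]\Big),$$ $$\mathrm{Reg}^{\min}_{(n,m,q),\alpha,g}(\mathcal A)=\sup_{E\in\mathcal E_{n,m,q}}\Big(\mathbb E[g(\mathcal A(E))]-\alpha\min_{\ell\in\Delta(E)}g(\ell)\Big),$$ where a supremum over the empty set is $-\infty$. **Corollary (Randomized Minimax Optimality of WF).** For all $n,m\in\mathbb N$, $q>0$, $\alpha>0$: 1. for every symmetric (i.e. invariant under permutations of the coordinates) concave $f:\mathbb R^n_{\ge0}\to\mathbb R_{\ge0}$ and every randomized policy $\mathcal A$, $\ \mathrm{Reg}^{\max}_{(n,m,q),\alpha,f}(\mathrm{WF})\le \mathrm{Reg}^{\max}_{(n,m,q),\alpha,f}(\mathcal A)$; 2. for every symmetric convex $g:\mathbb R^n_{\ge0}\to\mathbb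 R_{\ge0}$ and every randomized policy $\mathcal A$, $\ \mathrm{Reg}^{\min}_{(n,m,q),\alpha,g}(\mathrm{WF})\le \mathrm{Reg}^{\min}_{(n,m,q),\alpha,g}(\mathcal A)$. -/

import Mathlib

open MeasureTheory

namespace OnlineAllocation

/-- An online node arriving in a system with `n` offline nodes: its (non-empty) set of compatible
offline nodes and its (positive) divisible quantity. -/
structure Request (n : ℕ) where
  nbhd : Finset (Fin n)
  nonempty : nbhd.Nonempty
  qty : ℝ
  qty_pos : 0 < qty

/-- The feasible allocations of one online node: non-negative vectors that vanish outside the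
neighbourhood (compatibility) and whose entries sum to the quantity (full distribution). -/
def Request.allocations {n : ℕ} (r : Request n) : Set (Fin n → ℝ) :=
  {x | (∀ i, 0 ≤ x i) ∧ (∀ i, i ∉ r.nbhd → x i = 0) ∧ ∑ i, x i = r.qty}

/-- The request sequences with `n` offline nodes, `m` online nodes and total quantity `q`. -/
def requestSeqs (n m : ℕ) (q : ℝ) : Set (Fin m → Request n) :=
  {E | ∑ t, (E t).qty = q}

/-- The feasible load vectors on a request sequence: the Minkowski sum over the online nodes of
their sets of feasible allocations. -/
def feasibleLoads {n m : ℕ} (E : Fin m → Request n) : Set (Fin n → ℝ) :=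
  {l | ∃ x : Fin m → Fin n → ℝ, (∀ t, x t ∈ (E t).allocations) ∧ l = ∑ t, x t}

/-- A history: the past requests in order of arrival, each with the allocation chosen for it. -/
abbrev History (n : ℕ) : Type := List (Request n × (Fin n → ℝ))

/-- The load vector accumulated along a history. -/
def History.load {n : ℕ} (h : History n) : Fin n → ℝ := (h.map Prod.snd).sum

/-- A deterministic allocation policy maps the history of arrivals and decisions and the current
request to a feasible allocation of the current request. -/
structure Policy (n : ℕ) where
  act : History n → Request n → (Fin n → ℝ)
  feasible : ∀ h r, act h r ∈ r.allocations

/-- The history produced by running a policy on a list of requests, starting from nothing. -/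
def Policy.run {n : ℕ} (π : Policy n) (E : List (Request n)) : History n :=
  E.foldl (fun h r => h ++ [(r, π.act h r)]) []

/-- The final load vector produced by a policy on a request sequence. -/
def Policy.load {n m : ℕ} (π : Policy n) (E : Fin m → Request n) : Fin n → ℝ :=
  (π.run (List.ofFn E)).load

/-- A randomized allocation policy: the random coin flips `ω` are drawn from a probability space,
and each outcome determines an allocation policy. On every fixed request sequence (of any length)
the resulting load vector is a random vector. -/
structure RandomizedPolicy (n : ℕ) where
  Ω : Type*
  [measurableSpace : MeasurableSpace Ω]
  μ : Measure Ω
  [isProbabilityMeasure : IsProbabilityMeasure μ]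
  policy : Ω → Policy n
  measurable_load : ∀ (m : ℕ) (E : Fin m → Request n), Measurable fun ω => (policy ω).load E

attribute [instance] RandomizedPolicy.measurableSpace RandomizedPolicy.isProbabilityMeasure

/-- A deterministic policy as a randomized policy without coin flips. -/
noncomputable def Policy.toRandomized {n : ℕ} (π : Policy n) : RandomizedPolicy.{0} n where
  Ω := Unit
  μ := Measure.dirac ()
  policy := fun _ => π
  measurable_load := fun _ _ => measurable_const

/-- The quantity maximized by water-filling: the smallest load of a compatible offline node after
adding the allocation `x` to the load vector `l`. -/
noncomputable def minLoad {n : ℕ} (r : Request n) (l x : Fin n → ℝ) : ℝ :=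
  r.nbhd.inf' r.nonempty fun i => x i + l i

/-- The maximum in the definition of water-filling is attained. -/
theorem exists_waterFillingStep {n : ℕ} (r : Request n) (l : Fin n → ℝ) :
    ∃ x ∈ r.allocations, ∀ y ∈ r.allocations, minLoad r l y ≤ minLoad r l x := by
  have hne : r.allocations.Nonempty := by
    obtain ⟨j, hj⟩ := r.nonempty
    refine ⟨Pi.single j r.qty, fun i => ?_, fun i hi => ?_, ?_⟩
    · by_cases h : i = j
      · subst h; simpa using r.qty_pos.le
      · simp [h]
    · have : i ≠ j := fun h => hi (h ▸ hj)
      simp [this]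
    · simp
  have hcl : IsClosed r.allocations := by
    have : r.allocations = (⋂ i, {x : Fin n → ℝ | 0 ≤ x i}) ∩
        ((⋂ i, {x : Fin n → ℝ | i ∉ r.nbhd → x i = 0}) ∩ {x | ∑ i, x i = r.qty}) := by
      ext x; simp [Request.allocations]
    rw [this]
    refine (isClosed_iInter fun i => isClosed_le continuous_const (continuous_apply i)).inter
      ((isClosed_iInter fun i => ?_).inter
        (isClosed_eq (continuous_finsetSum _ fun i _ => continuous_apply i) continuous_const))
    by_cases h : i ∈ r.nbhd
    · simp [h]
    · simpa [h] using isClosed_eq (continuous_apply i) continuous_const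
  have hsub : r.allocations ⊆ Set.Icc 0 (fun _ => r.qty) := by
    rintro x ⟨h0, -, hs⟩
    refine ⟨h0, fun i => ?_⟩
    rw [← hs]
    exact Finset.single_le_sum (fun j _ => h0 j) (Finset.mem_univ i)
  have hc : IsCompact r.allocations := isCompact_Icc.of_isClosed_subset hcl hsub
  have hcont : Continuous fun x => minLoad r l x := by
    unfold minLoad
    exact Continuous.finset_inf'_apply r.nonempty
      fun i _ => (continuous_apply i).add continuous_const
  obtain ⟨x, hx, hmax⟩ := hc.exists_isMaxOn hne hcont.continuousOn
  exact ⟨x, hx, fun y hy => hmax hy⟩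

/-- The water-filling policy: allocate the arriving request so as to maximize the minimal
cumulative load of the compatible offline nodes (the maximizer is unique). -/
noncomputable def waterFilling (n : ℕ) : Policy n where
  act := fun h r => (exists_waterFillingStep r h.load).choose
  feasible := fun h r => (exists_waterFillingStep r h.load).choose_spec.1

/-- The cost of a policy on a request sequence for a maximization objective. -/
noncomputable def maxCost {n m : ℕ} (α : ℝ) (f : (Fin n → ℝ) → ℝ) (A : RandomizedPolicy n)
    (E : Fin m → Request n) : ℝ :=
  α * sSup (f '' feasibleLoads E) - ∫ ω, f ((A.policy ω).load E) ∂A.μ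

/-- The cost of a policy on a request sequence for a minimization objective. -/
noncomputable def minCost {n m : ℕ} (α : ℝ) (g : (Fin n → ℝ) → ℝ) (A : RandomizedPolicy n)
    (E : Fin m → Request n) : ℝ :=
  (∫ ω, g ((A.policy ω).load E) ∂A.μ) - α * sInf (g '' feasibleLoads E)

/-- The worst-case `α`-regret against an oblivious adversary, maximization objective. -/
noncomputable def maxRegret (n m : ℕ) (q α : ℝ) (f : (Fin n → ℝ) → ℝ)
    (A : RandomizedPolicy n) : EReal :=
  ⨆ E ∈ requestSeqs n m q, (maxCost α f A E : EReal)

/-- The worst-case `α`-regret against an oblivious adversary, minimization objective. -/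
noncomputable def minRegret (n m : ℕ) (q α : ℝ) (g : (Fin n → ℝ) → ℝ)
    (A : RandomizedPolicy n) : EReal :=
  ⨆ E ∈ requestSeqs n m q, (minCost α g A E : EReal)

/-- The non-negative orthant, the domain of the objectives. -/
def orthant (n : ℕ) : Set (Fin n → ℝ) := {x | ∀ i, 0 ≤ x i}

/-- A function on the non-negative orthant is symmetric if permuting the coordinates of the
argument does not change its value. -/
def IsSymmetricOnOrthant {n : ℕ} (f : (Fin n → ℝ) → ℝ) : Prop :=
  ∀ σ : Equiv.Perm (Fin n), ∀ x ∈ orthant n, f (x ∘ σ) = f x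

end OnlineAllocation

/-! Fix a sequence `E` with final water-filling load `ℓ` and water levels `h t`. Enlarge each
neighbourhood to all nodes with `ℓ i ≥ h t` and let the requests arrive by increasing level. This
nested instance has at least the feasible loads of `E`. When its nodes are relabeled uniformly at
random, no policy can tell apart the nodes that are still compatible, so every policy has the same
expected load `w` in the original labels, with each quantity spread evenly
(`Policy.average_load_relabel`). By Jensen and symmetry, the average cost over relabelings is at
least `g w`.

It remains to see `g ℓ ≤ g w`, which holds because `ℓ` is majorized by `w`, i.e. lies in the convex
hull of the permutations of `w` (`waterFilling_load_mem_convexHull`). By separation and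
rearrangement it suffices to compare linear functionals ordered like `ℓ`. There a layer-cake formula
applies: water-filling raises nodes only up to `h t`, and the average of the coefficients over `{ℓ ≥
u}` increases with `u`. Some relabeling is then as bad as the average
(`exists_adversarial_requestSeq`). Maximization follows by negating the objective. -/

namespace OnlineAllocation

/-! ### Optimality condition for a water-filling step -/

section WaterLevel

variable {n : ℕ}

/-- A water-filling step raises every node that receives a positive amount exactly to the
minimal load of the neighbourhood. -/
theorem add_eq_minLoad_of_isMax {r : Request n} {l x : Fin n → ℝ} (hx : x ∈ r.allocations)
    (hmax : ∀ y ∈ r.allocations, minLoad r l y ≤ minLoad r l x) {i : Fin n} (hi : 0 < x i) :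
    x i + l i = minLoad r l x := by
  have hiN : i ∈ r.nbhd := by
    by_contra h
    exact hi.ne' (hx.2.1 i h)
  have hle : ∀ j ∈ r.nbhd, minLoad r l x ≤ x j + l j := fun j hj =>
    Finset.inf'_le (fun j => x j + l j) hj
  by_contra hne
  have hlt : minLoad r l x < x i + l i := lt_of_le_of_ne (hle i hiN) (Ne.symm hne)
  -- If `i` ends above the minimum, take `ε` from it and share it equally over the neighbourhood,
  -- `i` included. The first bound keeps `x i` non-negative, the second keeps `i` above the old
  -- minimum.
  obtain ⟨ε, hε0, hε⟩ : ∃ ε, 0 < ε ∧ ε ≤ x i ∧ ε < x i + l i - minLoad r l x := by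
    refine ⟨min (x i) ((x i + l i - minLoad r l x) / 2), lt_min hi (by linarith),
      min_le_left _ _, (min_le_right _ _).trans_lt (by linarith)⟩
  have hN : (0 : ℝ) < r.nbhd.card := by exact_mod_cast r.nonempty.card_pos
  have hd : 0 < ε / r.nbhd.card := div_pos hε0 hN
  let y : Fin n → ℝ := fun j =>
    x j + (if j ∈ r.nbhd then ε / r.nbhd.card else 0) - (if j = i then ε else 0)
  have hy : y ∈ r.allocations := by
    refine ⟨fun j => ?_, fun j hj => ?_, ?_⟩
    · have h1 := hx.1 j
      by_cases hji : j = i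
      · subst hji
        simp only [y, hiN, if_true]
        linarith [hε.1]
      · simp only [y, hji, if_false]
        split_ifs <;> linarith
    · have hji : j ≠ i := fun h => hj (h ▸ hiN)
      simp [y, hj, hji, hx.2.1 j hj]
    · simp only [y, Finset.sum_sub_distrib, Finset.sum_add_distrib, hx.2.2]
      simp [Finset.sum_ite_mem]
      field_simp
      ring
  have hgt : minLoad r l x < minLoad r l y := by
    refine (Finset.lt_inf'_iff r.nonempty).2 fun j hj => ?_
    by_cases hji : j = i
    · subst hji
      simp only [y, hiN, if_true]
      linarith [hε.2]
    · simp only [y, hji, hj, if_true, if_false]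
      linarith [hle j hj]
  exact absurd (hmax y hy) (not_le.2 hgt)

end WaterLevel

/-! ### Loads and water levels along a run -/

section Run

variable {n m : ℕ}

/-- The load vector of a policy after the first `k` requests. -/
def Policy.partialLoad (π : Policy n) (E : Fin m → Request n) (k : ℕ) : Fin n → ℝ :=
  (π.run ((List.ofFn E).take k)).load

/-- The allocation that a policy chooses for the `t`-th request. -/
def Policy.alloc (π : Policy n) (E : Fin m → Request n) (t : Fin m) : Fin n → ℝ :=
  π.act (π.run ((List.ofFn E).take t)) (E t)

theorem Policy.alloc_mem (π : Policy n) (E : Fin m → Request n) (t : Fin m) :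
    π.alloc E t ∈ (E t).allocations := π.feasible _ _

theorem Policy.partialLoad_zero (π : Policy n) (E : Fin m → Request n) :
    π.partialLoad E 0 = 0 := by
  simp [Policy.partialLoad, Policy.run, History.load]

theorem Policy.partialLoad_last (π : Policy n) (E : Fin m → Request n) :
    π.partialLoad E m = π.load E := by
  rw [Policy.partialLoad, Policy.load, List.take_of_length_le (by simp)]

theorem Policy.partialLoad_succ (π : Policy n) (E : Fin m → Request n) (t : Fin m) :
    π.partialLoad E (t + 1) = π.partialLoad E t + π.alloc E t := by
  have h : (List.ofFn E).take (t + 1) = (List.ofFn E).take t ++ [E t] := by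
    rw [List.take_succ_eq_append_getElem (by simp)]
    simp
  simp [Policy.partialLoad, Policy.alloc, h, Policy.run, History.load]

theorem Policy.load_eq_sum (π : Policy n) (E : Fin m → Request n) :
    π.load E = ∑ t, π.alloc E t := by
  have h := Finset.sum_range_sub (π.partialLoad E) m
  rw [Finset.sum_range, π.partialLoad_zero, π.partialLoad_last, sub_zero] at h
  rw [← h]
  exact Finset.sum_congr rfl fun t _ => by rw [π.partialLoad_succ, add_sub_cancel_left]

/-- Causality: a decision cannot depend on future requests. This is what the adversary exploits. -/
theorem Policy.alloc_congr (π : Policy n) {E E' : Fin m → Request n} {t : Fin m}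
    (h : ∀ s ≤ t, E s = E' s) : π.alloc E t = π.alloc E' t := by
  have h' : (List.ofFn E).take t = (List.ofFn E').take t := by
    refine List.ext_getElem (by simp) fun k hk _ => ?_
    simp only [List.length_take, lt_inf_iff] at hk
    simpa using h _ hk.1.le
  rw [Policy.alloc, Policy.alloc, h', h t le_rfl]

theorem Policy.load_mem_feasibleLoads (π : Policy n) (E : Fin m → Request n) :
    π.load E ∈ feasibleLoads E :=
  ⟨π.alloc E, π.alloc_mem E, π.load_eq_sum E⟩

theorem mem_orthant_of_mem_feasibleLoads {E : Fin m → Request n} {l : Fin n → ℝ}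
    (hl : l ∈ feasibleLoads E) : l ∈ orthant n := by
  obtain ⟨x, hx, rfl⟩ := hl
  intro i
  rw [Finset.sum_apply]
  exact Finset.sum_nonneg fun t _ => (hx t).1 i

theorem sum_eq_of_mem_feasibleLoads {E : Fin m → Request n} {q : ℝ} (hE : E ∈ requestSeqs n m q)
    {l : Fin n → ℝ} (hl : l ∈ feasibleLoads E) : ∑ i, l i = q := by
  obtain ⟨x, hx, rfl⟩ := hl
  simp only [Finset.sum_apply]
  rw [Finset.sum_comm]
  exact (Finset.sum_congr rfl fun t _ => (hx t).2.2).trans hE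

/-- The water level reached by water-filling on the `t`-th request. -/
noncomputable def waterLevel (E : Fin m → Request n) (t : Fin m) : ℝ :=
  minLoad (E t) ((waterFilling n).partialLoad E t) ((waterFilling n).alloc E t)

theorem waterFilling_partialLoad_succ_eq (E : Fin m → Request n) (t : Fin m) (i : Fin n)
    (h : (waterFilling n).partialLoad E t i < (waterFilling n).partialLoad E (t + 1) i) :
    (waterFilling n).partialLoad E (t + 1) i = waterLevel E t := by
  rw [Policy.partialLoad_succ, Pi.add_apply] at h ⊢
  rw [add_comm]
  exact add_eq_minLoad_of_isMax ((waterFilling n).alloc_mem E t)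
    (exists_waterFillingStep (E t) ((waterFilling n).partialLoad E t)).choose_spec.2
    (by linarith)

theorem Policy.partialLoad_le_succ (π : Policy n) (E : Fin m → Request n) (t : Fin m) :
    π.partialLoad E t ≤ π.partialLoad E (t + 1) := by
  rw [π.partialLoad_succ]
  exact le_add_of_nonneg_right (π.alloc_mem E t).1

theorem Policy.partialLoad_mono (π : Policy n) (E : Fin m → Request n) {a b : ℕ} (hab : a ≤ b)
    (hb : b ≤ m) : π.partialLoad E a ≤ π.partialLoad E b := by
  induction b, hab using Nat.le_induction with
  | base => exact le_rfl
  | succ k _ ih => exact (ih (by omega)).trans (π.partialLoad_le_succ E ⟨k, by omega⟩)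

theorem waterLevel_le_load (E : Fin m → Request n) (t : Fin m) {i : Fin n}
    (hi : i ∈ (E t).nbhd) : waterLevel E t ≤ (waterFilling n).load E i := by
  have h1 : waterLevel E t ≤ (waterFilling n).partialLoad E (t + 1) i := by
    rw [Policy.partialLoad_succ, Pi.add_apply, add_comm]
    exact Finset.inf'_le (fun j => (waterFilling n).alloc E t j +
      (waterFilling n).partialLoad E t j) hi
  rw [← Policy.partialLoad_last]
  exact h1.trans ((waterFilling n).partialLoad_mono E t.2 le_rfl i)

end Run

end OnlineAllocation

namespace OnlineAllocation

/-! ### Majorization of the water-filling load -/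

section Majorization

variable {n m : ℕ}

/-- The nodes whose load is at least `h`. -/
noncomputable def upperNodes (l : Fin n → ℝ) (h : ℝ) : Finset (Fin n) :=
  Finset.univ.filter fun i => h ≤ l i

theorem mem_upperNodes {l : Fin n → ℝ} {h : ℝ} {i : Fin n} : i ∈ upperNodes l h ↔ h ≤ l i := by
  simp [upperNodes]

theorem upperNodes_anti (l : Fin n → ℝ) : Antitone (upperNodes l) := fun _ _ hab _ hi =>
  mem_upperNodes.2 (hab.trans (mem_upperNodes.1 hi))

/-- The average of `c` over the nodes whose load is at least `h`. -/
noncomputable def upperAverage (l c : Fin n → ℝ) (h : ℝ) : ℝ :=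
  (∑ i ∈ upperNodes l h, c i) / (upperNodes l h).card

/-- Raising the threshold discards nodes whose coefficients are at most those of all remaining
nodes. Non-emptiness matters: above the largest load the average is `0 / 0 = 0`. -/
theorem upperAverage_mono {l c : Fin n → ℝ} (hc : ∀ i j, l i < l j → c i ≤ c j) {a b : ℝ}
    (hab : a ≤ b) (hb : (upperNodes l b).Nonempty) :
    upperAverage l c a ≤ upperAverage l c b := by
  have hsub := upperNodes_anti l hab
  have hk : (0 : ℝ) < (upperNodes l b).card := by exact_mod_cast hb.card_pos
  have hka : (0 : ℝ) < (upperNodes l a).card := by exact_mod_cast (hb.mono hsub).card_pos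
  have hcard : ((upperNodes l a \ upperNodes l b).card : ℝ) + (upperNodes l b).card =
      (upperNodes l a).card := by
    exact_mod_cast Finset.card_sdiff_add_card_eq_card hsub
  have hsum := Finset.sum_sdiff (f := c) hsub
  have hcross : ((upperNodes l b).card : ℝ) * ∑ i ∈ upperNodes l a \ upperNodes l b, c i ≤
      (upperNodes l a \ upperNodes l b).card * ∑ j ∈ upperNodes l b, c j := by
    have h1 : ∑ i ∈ upperNodes l a \ upperNodes l b, ∑ _j ∈ upperNodes l b, c i ≤
        ∑ _i ∈ upperNodes l a \ upperNodes l b, ∑ j ∈ upperNodes l b, c j := by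
      refine Finset.sum_le_sum fun i hi => Finset.sum_le_sum fun j hj => hc i j ?_
      have hi' := (Finset.mem_sdiff.1 hi).2
      rw [mem_upperNodes, not_le] at hi'
      exact hi'.trans_le (mem_upperNodes.1 hj)
    simpa [Finset.mul_sum] using h1
  rw [upperAverage, upperAverage, div_le_div_iff₀ hka hk, ← hsum, ← hcard]
  linarith

theorem upperAverage_monotoneOn {l c : Fin n → ℝ} (hc : ∀ i j, l i < l j → c i ≤ c j)
    (i : Fin n) : MonotoneOn (upperAverage l c) (Set.Iic (l i)) := fun _ _ _ hb hab =>
  upperAverage_mono hc hab ⟨i, mem_upperNodes.2 hb⟩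

theorem card_mul_upperAverage (l c : Fin n → ℝ) (h : ℝ) :
    (upperNodes l h).card * upperAverage l c h = ∑ i ∈ upperNodes l h, c i := by
  rcases (upperNodes l h).eq_empty_or_nonempty with he | hne
  · simp [he]
  · have : ((upperNodes l h).card : ℝ) ≠ 0 := by exact_mod_cast hne.card_pos.ne'
    rw [upperAverage]
    field_simp

/-- Layer cake: at each height `h > 0`, replacing the coefficients of the nodes reaching `h` by
their average preserves their sum. -/
theorem sum_integral_upperAverage {l c : Fin n → ℝ} (hc : ∀ i j, l i < l j → c i ≤ c j)
    (hl : ∀ i, 0 ≤ l i) : ∑ i, ∫ h in (0 : ℝ)..l i, upperAverage l c h = ∑ i, c i * l i := by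
  have hint : ∀ i, IntegrableOn (upperAverage l c) (Set.Ioc 0 (l i)) := fun i =>
    (((upperAverage_monotoneOn hc i).mono Set.Icc_subset_Iic_self).integrableOn_isCompact
      isCompact_Icc).mono_set Set.Ioc_subset_Icc_self
  have h1 : ∀ i, ∫ h in (0 : ℝ)..l i, upperAverage l c h =
      ∫ h, (Set.Ioc 0 (l i)).indicator (upperAverage l c) h := fun i => by
    rw [intervalIntegral.integral_of_le (hl i), integral_indicator measurableSet_Ioc]
  have h2 : ∀ i, c i * l i = ∫ h, (Set.Ioc 0 (l i)).indicator (fun _ => c i) h := fun i => by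
    rw [integral_indicator measurableSet_Ioc]
    simp [hl i, mul_comm]
  simp only [h1, h2]
  rw [← integral_finsetSum _ fun i _ => (hint i).integrable_indicator measurableSet_Ioc,
    ← integral_finsetSum _ fun i _ => IntegrableOn.integrable_indicator
      (integrableOn_const (by simp)) measurableSet_Ioc]
  congr 1
  ext h
  by_cases h0 : 0 < h
  · have hL := card_mul_upperAverage l c h
    simp only [Set.indicator_apply, Set.mem_Ioc, h0, true_and]
    rw [← Finset.sum_filter, ← Finset.sum_filter, Finset.sum_const, nsmul_eq_mul]
    exact hL
  · simp [h0]

/-- If a load is built up by steps each of which ends at height `h t`, then the weighted sum of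
a monotone function of these heights dominates its integral. -/
theorem integral_le_sum_step {φ : ℝ → ℝ} {P : ℕ → ℝ} {h : Fin m → ℝ} (h0 : P 0 = 0)
    (hmono : ∀ t : Fin m, P t ≤ P (t + 1)) (hlast : ∀ k ≤ m, P k ≤ P m)
    (hstep : ∀ t : Fin m, P t < P (t + 1) → P (t + 1) = h t)
    (hφ : MonotoneOn φ (Set.Iic (P m))) :
    ∫ u in (0 : ℝ)..P m, φ u ≤ ∑ t : Fin m, (P (t + 1) - P t) * φ (h t) := by
  have hint : ∀ k < m, IntervalIntegrable φ volume (P k) (P (k + 1)) := fun k hk =>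
    (hφ.mono fun u hu => by
      rw [Set.uIcc_of_le (hmono ⟨k, hk⟩)] at hu
      exact hu.2.trans (hlast _ hk)).intervalIntegrable
  -- Split the integral at the successive loads; on each piece `φ` is at most its value at the right
  -- end, which is `h t` if the piece is non-trivial.
  rw [← h0, ← intervalIntegral.sum_integral_adjacent_intervals hint, Finset.sum_range]
  refine Finset.sum_le_sum fun t _ => ?_
  rcases (hmono t).eq_or_lt with he | hlt
  · simp [← he]
  · rw [← hstep t hlt, ← smul_eq_mul, ← intervalIntegral.integral_const]
    refine intervalIntegral.integral_mono_on (hmono t) (hint t t.2)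
      intervalIntegrable_const fun u hu => ?_
    exact hφ (hu.2.trans (hlast _ t.2)) (hlast _ t.2) hu.2

/-- The load vector obtained by spreading each quantity `q t` evenly over the nodes whose load
in `l` is at least `h t`. -/
noncomputable def spreadLoad (l : Fin n → ℝ) (h q : Fin m → ℝ) (i : Fin n) : ℝ :=
  ∑ t, if i ∈ upperNodes l (h t) then q t / (upperNodes l (h t)).card else 0

theorem sum_mul_spreadLoad (l c : Fin n → ℝ) (h q : Fin m → ℝ) :
    ∑ i, c i * spreadLoad l h q i = ∑ t, q t * upperAverage l c (h t) := by
  simp only [spreadLoad, Finset.mul_sum]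
  rw [Finset.sum_comm]
  refine Finset.sum_congr rfl fun t _ => ?_
  simp only [mul_ite, mul_zero, Finset.sum_ite_mem, Finset.univ_inter]
  rw [← Finset.sum_mul, upperAverage]
  ring

variable {P : ℕ → Fin n → ℝ} {h : Fin m → ℝ}

theorem sum_mul_le_sum_mul_spreadLoad (h0 : P 0 = 0) (hmono : ∀ t : Fin m, P t ≤ P (t + 1))
    (hlast : ∀ k ≤ m, P k ≤ P m)
    (hstep : ∀ (t : Fin m) i, P t i < P (t + 1) i → P (t + 1) i = h t)
    {c : Fin n → ℝ} (hc : ∀ i j, P m i < P m j → c i ≤ c j) :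
    ∑ i, c i * P m i ≤
      ∑ i, c i * spreadLoad (P m) h (fun t => ∑ i, (P (t + 1) i - P t i)) i := by
  rw [sum_mul_spreadLoad, ← sum_integral_upperAverage hc fun i => by
    simpa [h0] using hlast 0 (Nat.zero_le m) i]
  calc ∑ i, ∫ u in (0 : ℝ)..P m i, upperAverage (P m) c u
      ≤ ∑ i, ∑ t : Fin m, (P (t + 1) i - P t i) * upperAverage (P m) c (h t) :=
        Finset.sum_le_sum fun i _ => integral_le_sum_step (P := fun k => P k i)
          (by simp [h0]) (fun t => hmono t i) (fun k hk => hlast k hk i)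
          (fun t => hstep t i) (upperAverage_monotoneOn hc i)
    _ = _ := by
        rw [Finset.sum_comm]
        exact Finset.sum_congr rfl fun t _ => (Finset.sum_mul _ _ _).symm

theorem exists_perm_comp_monovary (c l : Fin n → ℝ) :
    ∃ ρ : Equiv.Perm (Fin n), ∀ i j, l i < l j → c (ρ i) ≤ c (ρ j) := by
  refine ⟨(Tuple.sort l).symm.trans (Tuple.sort c), fun i j hij => ?_⟩
  refine Tuple.monotone_sort c (le_of_not_gt fun hlt => ?_)
  have := Tuple.monotone_sort l hlt.le
  simp only [Function.comp_apply, Equiv.apply_symm_apply] at this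
  exact absurd hij (not_lt.2 this)

/-- Dominance of all similarly ordered linear functionals puts `l` into the convex hull of the
permutations of `w`. -/
theorem mem_convexHull_perm {l w : Fin n → ℝ}
    (H : ∀ c : Fin n → ℝ, (∀ i j, l i < l j → c i ≤ c j) → ∑ i, c i * l i ≤ ∑ i, c i * w i) :
    l ∈ convexHull ℝ (Set.range fun σ : Equiv.Perm (Fin n) => w ∘ σ) := by
  by_contra hnot
  obtain ⟨F, u, hF, hu⟩ := geometric_hahn_banach_closed_point
    (convex_convexHull ℝ (Set.range fun σ : Equiv.Perm (Fin n) => w ∘ σ))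
    ((Set.finite_range _).isClosed_convexHull ℝ) hnot
  let c : Fin n → ℝ := fun i => F (Pi.single i 1)
  have hFc : ∀ x, F x = ∑ i, c i * x i := fun x => by
    conv_lhs => rw [pi_eq_sum_univ' x]
    simp only [map_sum, map_smul, smul_eq_mul, c]
    exact Finset.sum_congr rfl fun i _ => mul_comm _ _
  -- The separating functional need not be ordered like `l`. Rearranging its coefficients can only
  -- increase its value at `l`, and its value at `w` becomes that of `c` at a permutation of `w`.
  obtain ⟨ρ, hρ⟩ := exists_perm_comp_monovary c l
  have h1 : ∑ i, c i * l i ≤ ∑ i, c (ρ i) * l i := by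
    have hm : Monovary (c ∘ ρ) l := fun i j hij => hρ i j hij
    simpa using hm.sum_comp_perm_mul_le_sum_mul (σ := ρ.symm)
  have h2 := H (c ∘ ρ) hρ
  have h3 : ∑ i, (c ∘ ρ) i * w i = ∑ i, c i * (w ∘ ρ.symm) i := by
    rw [← Equiv.sum_comp ρ (fun i => c i * (w ∘ ρ.symm) i)]
    simp
  have h4 := hF (w ∘ ρ.symm) (subset_convexHull ℝ _ ⟨ρ.symm, rfl⟩)
  rw [hFc] at hu h4
  simp only [Function.comp_apply] at h2 h3 h4
  linarith

theorem mem_convexHull_spreadLoad (h0 : P 0 = 0) (hmono : ∀ t : Fin m, P t ≤ P (t + 1))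
    (hlast : ∀ k ≤ m, P k ≤ P m)
    (hstep : ∀ (t : Fin m) i, P t i < P (t + 1) i → P (t + 1) i = h t) :
    P m ∈ convexHull ℝ (Set.range fun σ : Equiv.Perm (Fin n) =>
      spreadLoad (P m) h (fun t => ∑ i, (P (t + 1) i - P t i)) ∘ σ) :=
  mem_convexHull_perm fun _ hc => sum_mul_le_sum_mul_spreadLoad h0 hmono hlast hstep hc

end Majorization

end OnlineAllocation

namespace OnlineAllocation

/-! ### Random relabeling of nested instances -/

section Relabeling

variable {n m : ℕ}

/-- A request with the offline nodes relabeled by a permutation. -/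
def Request.relabel (σ : Equiv.Perm (Fin n)) (r : Request n) : Request n where
  nbhd := r.nbhd.map σ.toEmbedding
  nonempty := r.nonempty.map
  qty := r.qty
  qty_pos := r.qty_pos

theorem Request.mem_allocations_relabel {σ : Equiv.Perm (Fin n)} {r : Request n}
    {x : Fin n → ℝ} : x ∈ (r.relabel σ).allocations ↔ x ∘ σ ∈ r.allocations := by
  have h1 : (∀ i, 0 ≤ x i) ↔ ∀ i, 0 ≤ x (σ i) := (σ.forall_congr_right (q := fun i => 0 ≤ x i)).symm
  have h2 : (∀ i, i ∉ r.nbhd.map σ.toEmbedding → x i = 0) ↔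
      ∀ i, i ∉ r.nbhd → x (σ i) = 0 := by
    rw [← σ.forall_congr_right]
    simp
  have h3 : ∑ i, x (σ i) = ∑ i, x i := Equiv.sum_comp σ x
  simp only [Request.allocations, Request.relabel, Set.mem_ofPred_eq, Function.comp_apply, h1, h2,
    h3]

theorem Request.relabel_mul_swap {r : Request n} (σ : Equiv.Perm (Fin n)) {i j : Fin n}
    (hi : i ∈ r.nbhd) (hj : j ∈ r.nbhd) :
    r.relabel (σ * Equiv.swap i j) = r.relabel σ := by
  have h : ∀ k, Equiv.swap i j k ∈ r.nbhd ↔ k ∈ r.nbhd := fun k => by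
    rcases eq_or_ne k i with rfl | hki
    · simp [hi, hj]
    rcases eq_or_ne k j with rfl | hkj
    · simp [hi, hj]
    rw [Equiv.swap_apply_of_ne_of_ne hki hkj]
  unfold Request.relabel
  congr 1
  ext k
  simp only [Finset.mem_map_equiv]
  rw [Equiv.Perm.mul_def, Equiv.symm_trans_apply, Equiv.symm_swap, h]

/-- On a uniformly relabeled nested request sequence, every policy spreads each request evenly
over its neighbourhood in expectation. -/
theorem Policy.sum_alloc_relabel (π : Policy n) {F : Fin m → Request n}
    (hF : ∀ s t, s ≤ t → (F t).nbhd ⊆ (F s).nbhd) (t : Fin m) (i : Fin n) :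
    ∑ σ : Equiv.Perm (Fin n), π.alloc (fun s => (F s).relabel σ) t (σ i) =
      (n.factorial : ℝ) * if i ∈ (F t).nbhd then (F t).qty / (F t).nbhd.card else 0 := by
  set S : Fin n → ℝ := fun i =>
    ∑ σ : Equiv.Perm (Fin n), π.alloc (fun s => (F s).relabel σ) t (σ i) with hS
  have hmem : ∀ σ : Equiv.Perm (Fin n),
      π.alloc (fun s => (F s).relabel σ) t ∘ σ ∈ (F t).allocations := fun σ =>
    Request.mem_allocations_relabel.1 (π.alloc_mem _ t)
  have hzero : ∀ i, i ∉ (F t).nbhd → S i = 0 := fun i hi =>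
    Finset.sum_eq_zero fun σ _ => (hmem σ).2.1 i hi
  have hsum : ∑ i, S i = n.factorial * (F t).qty := by
    simp only [hS]
    rw [Finset.sum_comm]
    refine (Finset.sum_congr rfl fun σ _ => (hmem σ).2.2).trans ?_
    simp [Fintype.card_perm]
  -- Substitute `σ * swap i j` for `σ`. By nestedness `i` and `j` lie in every neighbourhood up to
  -- time `t`, so the policy sees the same prefix and acts identically.
  have heq : ∀ i ∈ (F t).nbhd, ∀ j ∈ (F t).nbhd, S i = S j := fun i hi j hj => by
    simp only [hS]
    rw [← Equiv.sum_comp (Equiv.mulRight (Equiv.swap i j))]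
    refine Finset.sum_congr rfl fun σ _ => ?_
    rw [Equiv.coe_mulRight, π.alloc_congr (E' := fun s => (F s).relabel σ) fun s hs =>
      Request.relabel_mul_swap σ (hF s t hs hi) (hF s t hs hj)]
    simp
  change S i = _
  split_ifs with hi
  · have h1 : ∑ j, S j = (F t).nbhd.card * S i := by
      rw [← Finset.sum_subset (Finset.subset_univ (F t).nbhd) fun j _ hj => hzero j hj,
        Finset.sum_congr rfl fun j hj => heq j hj i hi, Finset.sum_const, nsmul_eq_mul]
    have hN : ((F t).nbhd.card : ℝ) ≠ 0 := by exact_mod_cast (F t).nonempty.card_pos.ne'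
    rw [← mul_div_assoc, eq_div_iff hN, ← hsum, h1, mul_comm]
  · simp [hzero i hi]

theorem Policy.sum_load_relabel (π : Policy n) {F : Fin m → Request n}
    (hF : ∀ s t, s ≤ t → (F t).nbhd ⊆ (F s).nbhd) (i : Fin n) :
    ∑ σ : Equiv.Perm (Fin n), π.load (fun s => (F s).relabel σ) (σ i) =
      (n.factorial : ℝ) *
        ∑ t, if i ∈ (F t).nbhd then (F t).qty / (F t).nbhd.card else 0 := by
  simp only [π.load_eq_sum, Finset.sum_apply, Finset.mul_sum]
  rw [Finset.sum_comm]
  exact Finset.sum_congr rfl fun t _ => π.sum_alloc_relabel hF t i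

theorem relabel_mem_requestSeqs {F : Fin m → Request n} {q : ℝ} (hF : F ∈ requestSeqs n m q)
    (σ : Equiv.Perm (Fin n)) : (fun t => (F t).relabel σ) ∈ requestSeqs n m q := hF

theorem comp_symm_mem_feasibleLoads_relabel {F : Fin m → Request n} {l : Fin n → ℝ}
    (hl : l ∈ feasibleLoads F) (σ : Equiv.Perm (Fin n)) :
    l ∘ σ.symm ∈ feasibleLoads fun t => (F t).relabel σ := by
  obtain ⟨x, hx, rfl⟩ := hl
  refine ⟨fun t => x t ∘ σ.symm, fun t => Request.mem_allocations_relabel.2 ?_, ?_⟩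
  · simpa [Function.comp_assoc] using hx t
  · ext i
    simp

end Relabeling

/-! ### Boundedness and measurability of the objective -/

section Objective

variable {n : ℕ} {g : (Fin n → ℝ) → ℝ}

theorem map_average_le_of_convexOn {ι E : Type*} [Fintype ι] [Nonempty ι] [AddCommGroup E]
    [Module ℝ E] {s : Set E} {f : E → ℝ} (hf : ConvexOn ℝ s f) {p : ι → E} (hp : ∀ i, p i ∈ s) :
    f ((Fintype.card ι : ℝ)⁻¹ • ∑ i, p i) ≤ (Fintype.card ι : ℝ)⁻¹ * ∑ i, f (p i) := by
  have h := hf.map_sum_le (t := Finset.univ) (w := fun _ : ι => (Fintype.card ι : ℝ)⁻¹) (p := p)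
    (fun _ _ => by positivity) (by simp) fun i _ => hp i
  simpa [Finset.smul_sum, Finset.mul_sum] using h

theorem comp_perm_mem_orthant {x : Fin n → ℝ} (hx : x ∈ orthant n) (σ : Equiv.Perm (Fin n)) :
    x ∘ σ ∈ orthant n := fun i => hx (σ i)

/-- A symmetric convex function is bounded on the vectors of the orthant with a given sum. -/
theorem exists_abs_le_of_convexOn (hsym : IsSymmetricOnOrthant g)
    (hg : ConvexOn ℝ (orthant n) g) {q : ℝ} (hq : 0 < q) :
    ∃ C, ∀ x ∈ orthant n, ∑ i, x i = q → |g x| ≤ C := by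
  rcases n.eq_zero_or_pos with rfl | hn
  · exact ⟨0, fun x _ hx => absurd hx (by simpa using hq.ne)⟩
  have : NeZero n := ⟨hn.ne'⟩
  -- The average of the cyclic shifts of `x` is the constant vector.
  have hlow : ∀ x ∈ orthant n, ∑ i, x i = q → g (fun _ => (n : ℝ)⁻¹ * q) ≤ g x := by
    intro x hx hs
    have h := map_average_le_of_convexOn hg (p := fun k : Fin n => x ∘ Equiv.addRight k)
      fun k => comp_perm_mem_orthant hx _
    have h2 : ∑ k : Fin n, g (x ∘ Equiv.addRight k) = n * g x := by
      rw [Finset.sum_congr rfl fun k _ => hsym (Equiv.addRight k) x hx]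
      simp
    have h3 : (Fintype.card (Fin n) : ℝ)⁻¹ • ∑ k : Fin n, x ∘ Equiv.addRight k =
        fun _ => (n : ℝ)⁻¹ * q := by
      ext i
      simp only [Fintype.card_fin, Pi.smul_apply, Finset.sum_apply, Function.comp_apply,
        Equiv.coe_addRight, smul_eq_mul]
      rw [← hs, ← Equiv.sum_comp (Equiv.addLeft i) x]
      rfl
    have hn0 : (n : ℝ) ≠ 0 := by exact_mod_cast hn.ne'
    rw [h2, h3, Fintype.card_fin, inv_mul_cancel_left₀ hn0] at h
    exact h
  have hup : ∀ x ∈ orthant n, ∑ i, x i = q → g x ≤ g (Pi.single 0 q) := by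
    intro x hx hs
    have hv : ∀ i : Fin n, Pi.single i q ∈ orthant n := fun i j => by
      by_cases h : j = i
      · subst h; simpa using hq.le
      · simp [h]
    have hgv : ∀ i : Fin n, g (Pi.single i q) = g (Pi.single 0 q) := fun i => by
      rw [← hsym (Equiv.swap 0 i) _ (hv 0)]
      congr 1
      ext j
      simp only [Function.comp_apply, Pi.single_apply, Equiv.swap_apply_eq_iff,
        Equiv.swap_apply_left]
    have h := hg.map_sum_le (t := Finset.univ) (w := fun i => x i / q)
      (p := fun i => Pi.single i q) (fun i _ => div_nonneg (hx i) hq.le)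
      (by rw [← Finset.sum_div, hs, div_self hq.ne']) fun i _ => hv i
    have h2 : ∑ i, (x i / q) • (Pi.single i q : Fin n → ℝ) = x := by
      ext j
      simp [Finset.sum_apply, Pi.single_apply, hq.ne']
    rw [h2] at h
    simp only [hgv, smul_eq_mul] at h
    rwa [← Finset.sum_mul, ← Finset.sum_div, hs, div_self hq.ne', one_mul] at h
  refine ⟨max |g fun _ => (n : ℝ)⁻¹ * q| |g (Pi.single 0 q)|, fun x hx hs => ?_⟩
  exact abs_le_max_abs_abs (hlow x hx hs) (hup x hx hs)

/-- A convex function on the orthant is continuous on the relative interior of each face, so it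
is measurable along random vectors of the orthant. -/
theorem measurable_comp_of_convexOn_orthant (hg : ConvexOn ℝ (orthant n) g) {Ω : Type*}
    [MeasurableSpace Ω] {X : Ω → Fin n → ℝ} (hX : Measurable X) (hXo : ∀ ω, X ω ∈ orthant n) :
    Measurable fun ω => g (X ω) := by
  classical
  -- `g` may jump at the boundary, so each face is treated separately. `p S` kills the coordinates
  -- outside `S`, and `O S` constrains only those in `S`; thus `g ∘ p S` is convex on an open set,
  -- hence continuous there.
  let p : Finset (Fin n) → (Fin n → ℝ) →ₗ[ℝ] (Fin n → ℝ) := fun S =>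
    LinearMap.pi fun i => if i ∈ S then LinearMap.proj i else 0
  have hp : ∀ S y i, p S y i = if i ∈ S then y i else 0 := fun S y i => by
    simp only [p, LinearMap.pi_apply]
    split_ifs <;> simp
  let O : Finset (Fin n) → Set (Fin n → ℝ) := fun S => {y | ∀ i ∈ S, 0 < y i}
  have hO : ∀ S, IsOpen (O S) := fun S => by
    have : O S = ⋂ i ∈ S, {y | 0 < y i} := by ext; simp [O]
    rw [this]
    exact isOpen_biInter_finset fun i _ => isOpen_lt continuous_const (continuous_apply i)
  have hOc : ∀ S, Convex ℝ (O S) := fun S => by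
    have : O S = ⋂ i ∈ S, (LinearMap.proj i : (Fin n → ℝ) →ₗ[ℝ] ℝ) ⁻¹' Set.Ioi 0 := by
      ext; simp [O]
    rw [this]
    exact convex_iInter₂ fun i _ => (convex_Ioi 0).linear_preimage _
  have hcont : ∀ S, ContinuousOn (g ∘ p S) (O S) := fun S => by
    refine ((hg.comp_linearMap (p S)).subset (fun y hy i => ?_) (hOc S)).continuousOn (hO S)
    rw [hp]
    split_ifs with hi
    · exact (hy i hi).le
    · exact le_rfl
  have hG : ∀ S, Measurable ((O S).indicator (g ∘ p S)) := fun S => by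
    have := (hcont S).measurable_piecewise (g := fun _ => (0 : ℝ)) continuousOn_const
      (hO S).measurableSet
    rwa [show (fun _ : Fin n → ℝ => (0 : ℝ)) = 0 from rfl, Set.piecewise_eq_indicator] at this
  let B : Finset (Fin n) → Set Ω := fun S => {ω | ∀ i, i ∈ S ↔ 0 < X ω i}
  have hB : ∀ S, MeasurableSet (B S) := fun S => by
    have : B S = ⋂ i, {ω | i ∈ S ↔ 0 < X ω i} := by ext; simp [B]
    rw [this]
    refine MeasurableSet.iInter fun i => ?_
    have hpos : MeasurableSet {ω | 0 < X ω i} :=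
      measurableSet_lt measurable_const ((measurable_pi_apply i).comp hX)
    by_cases hi : i ∈ S
    · simpa [hi] using hpos
    · simpa [hi, B] using measurableSet_le ((measurable_pi_apply i).comp hX) measurable_const
  have hrepr : (fun ω => g (X ω)) = fun ω =>
      ∑ S, (B S).indicator (fun ω => (O S).indicator (g ∘ p S) (X ω)) ω := by
    ext ω
    let S₀ : Finset (Fin n) := Finset.univ.filter fun i => 0 < X ω i
    have hS₀ : ω ∈ B S₀ := fun i => by simp [S₀]
    rw [Finset.sum_eq_single S₀, Set.indicator_of_mem hS₀, Set.indicator_of_mem]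
    · simp only [Function.comp_apply]
      congr 1
      ext i
      rw [hp]
      split_ifs with hi
      · rfl
      · exact le_antisymm (not_lt.1 fun h => hi ((hS₀ i).2 h)) (hXo ω i)
    · exact fun i hi => (hS₀ i).1 hi
    · intro S _ hS
      refine Set.indicator_of_notMem (fun hmem => hS ?_) _
      ext i
      rw [hS₀ i, hmem i]
    · simp
  rw [hrepr]
  exact Finset.measurable_fun_sum _ fun S _ => ((hG S).comp hX).indicator (hB S)

end Objective

end OnlineAllocation

namespace OnlineAllocation

/-! ### The adversarial instance and the regret comparison -/

section Adversary

variable {n m : ℕ}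

/-- The order of arrival that sorts the requests by the water level they reach. -/
noncomputable def levelOrder (E : Fin m → Request n) : Equiv.Perm (Fin m) :=
  Tuple.sort (waterLevel E)

/-- The nested request sequence in which every neighbourhood is enlarged to all nodes whose final
water-filling load is at least the water level of the request, in order of increasing level. -/
noncomputable def nestedSeq (E : Fin m → Request n) (t : Fin m) : Request n where
  nbhd := upperNodes ((waterFilling n).load E) (waterLevel E (levelOrder E t))
  nonempty := (E (levelOrder E t)).nonempty.mono fun _ hi =>
    mem_upperNodes.2 (waterLevel_le_load E _ hi)
  qty := (E (levelOrder E t)).qty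
  qty_pos := (E (levelOrder E t)).qty_pos

theorem nestedSeq_nested (E : Fin m → Request n) (s t : Fin m) (hst : s ≤ t) :
    (nestedSeq E t).nbhd ⊆ (nestedSeq E s).nbhd :=
  upperNodes_anti _ (Tuple.monotone_sort (waterLevel E) hst)

theorem nestedSeq_mem_requestSeqs {E : Fin m → Request n} {q : ℝ} (hE : E ∈ requestSeqs n m q) :
    nestedSeq E ∈ requestSeqs n m q :=
  (Equiv.sum_comp (levelOrder E) fun t => (E t).qty).trans hE

theorem feasibleLoads_subset_nestedSeq (E : Fin m → Request n) :
    feasibleLoads E ⊆ feasibleLoads (nestedSeq E) := by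
  rintro _ ⟨x, hx, rfl⟩
  refine ⟨x ∘ levelOrder E, fun t => ⟨(hx _).1, fun i hi => (hx _).2.1 i fun hmem => hi ?_,
    (hx _).2.2⟩, (Equiv.sum_comp (levelOrder E) x).symm⟩
  exact mem_upperNodes.2 (waterLevel_le_load E _ hmem)

/-- The expected load of any policy on the uniformly relabeled nested sequence. -/
noncomputable def nestedLoad (E : Fin m → Request n) : Fin n → ℝ :=
  spreadLoad ((waterFilling n).load E) (waterLevel E) fun t => (E t).qty

theorem nestedLoad_eq (E : Fin m → Request n) (i : Fin n) :
    nestedLoad E i = ∑ t, if i ∈ (nestedSeq E t).nbhd then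
      (nestedSeq E t).qty / (nestedSeq E t).nbhd.card else 0 :=
  (Equiv.sum_comp (levelOrder E) fun t =>
    if i ∈ upperNodes ((waterFilling n).load E) (waterLevel E t) then
      (E t).qty / (upperNodes ((waterFilling n).load E) (waterLevel E t)).card else 0).symm

theorem nestedLoad_mem_orthant (E : Fin m → Request n) : nestedLoad E ∈ orthant n := fun i => by
  unfold nestedLoad spreadLoad
  refine Finset.sum_nonneg fun t _ => ?_
  have := (E t).qty_pos
  positivity

theorem waterFilling_load_mem_convexHull (E : Fin m → Request n) :
    (waterFilling n).load E ∈
      convexHull ℝ (Set.range fun σ : Equiv.Perm (Fin n) => nestedLoad E ∘ σ) := by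
  have h := mem_convexHull_spreadLoad (P := (waterFilling n).partialLoad E) (h := waterLevel E)
    (Policy.partialLoad_zero _ _) ((waterFilling n).partialLoad_le_succ E)
    (fun k hk => (waterFilling n).partialLoad_mono E hk le_rfl)
    (waterFilling_partialLoad_succ_eq E)
  have hq : (fun t : Fin m => ∑ i, ((waterFilling n).partialLoad E (t + 1) i -
      (waterFilling n).partialLoad E t i)) = fun t => (E t).qty := by
    ext t
    simp only [Policy.partialLoad_succ, Pi.add_apply, add_sub_cancel_left]
    exact ((waterFilling n).alloc_mem E t).2.2
  rwa [hq, Policy.partialLoad_last] at h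

theorem Policy.average_load_relabel (π : Policy n) (E : Fin m → Request n) :
    (Fintype.card (Equiv.Perm (Fin n)) : ℝ)⁻¹ • ∑ σ : Equiv.Perm (Fin n),
      π.load (fun t => (nestedSeq E t).relabel σ) ∘ σ = nestedLoad E := by
  ext i
  have h := π.sum_load_relabel (nestedSeq_nested E) i
  simp only [Pi.smul_apply, Finset.sum_apply, Function.comp_apply, smul_eq_mul]
  rw [h, ← nestedLoad_eq, Fintype.card_perm, Fintype.card_fin,
    inv_mul_cancel_left₀ (by exact_mod_cast n.factorial_ne_zero)]

variable {g : (Fin n → ℝ) → ℝ} {q : ℝ}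

/-- Rules out the default value `0` of the Bochner integral. -/
theorem integrable_comp_load (hsym : IsSymmetricOnOrthant g) (hg : ConvexOn ℝ (orthant n) g)
    (hq : 0 < q) (A : RandomizedPolicy n) {E : Fin m → Request n} (hE : E ∈ requestSeqs n m q) :
    Integrable (fun ω => g ((A.policy ω).load E)) A.μ := by
  obtain ⟨C, hC⟩ := exists_abs_le_of_convexOn hsym hg hq
  have hl := fun ω => (A.policy ω).load_mem_feasibleLoads E
  refine Integrable.of_bound (measurable_comp_of_convexOn_orthant hg (A.measurable_load m E)
    fun ω => mem_orthant_of_mem_feasibleLoads (hl ω)).aestronglyMeasurable C ?_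
  exact Filter.Eventually.of_forall fun ω =>
    hC _ (mem_orthant_of_mem_feasibleLoads (hl ω)) (sum_eq_of_mem_feasibleLoads hE (hl ω))

/-- Against every randomized policy, each request sequence can be replaced by one with at least
the same attainable objective values on which the policy does no better than water-filling did on
the original sequence. -/
theorem exists_adversarial_requestSeq (hsym : IsSymmetricOnOrthant g)
    (hg : ConvexOn ℝ (orthant n) g) (hq : 0 < q) (A : RandomizedPolicy n)
    {E : Fin m → Request n} (hE : E ∈ requestSeqs n m q) :
    ∃ E' ∈ requestSeqs n m q, g '' feasibleLoads E ⊆ g '' feasibleLoads E' ∧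
      g ((waterFilling n).load E) ≤ ∫ ω, g ((A.policy ω).load E') ∂A.μ := by
  let F : Equiv.Perm (Fin n) → Fin m → Request n := fun σ t => (nestedSeq E t).relabel σ
  have hF : ∀ σ, F σ ∈ requestSeqs n m q := fun σ =>
    relabel_mem_requestSeqs (nestedSeq_mem_requestSeqs hE) σ
  have hload : ∀ ω σ, (A.policy ω).load (F σ) ∈ orthant n := fun ω σ =>
    mem_orthant_of_mem_feasibleLoads ((A.policy ω).load_mem_feasibleLoads (F σ))
  have hint : ∀ σ, Integrable (fun ω => g ((A.policy ω).load (F σ))) A.μ := fun σ =>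
    integrable_comp_load hsym hg hq A (hF σ)
  have hcard : (0 : ℝ) < Fintype.card (Equiv.Perm (Fin n)) := by
    exact_mod_cast Fintype.card_pos
  have hpoint : ∀ ω, Fintype.card (Equiv.Perm (Fin n)) * g (nestedLoad E) ≤
      ∑ σ, g ((A.policy ω).load (F σ)) := fun ω => by
    have h := map_average_le_of_convexOn hg (p := fun σ => (A.policy ω).load (F σ) ∘ σ)
      fun σ => comp_perm_mem_orthant (hload ω σ) σ
    rw [(A.policy ω).average_load_relabel E,
      Finset.sum_congr rfl fun σ _ => hsym σ _ (hload ω σ)] at h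
    rwa [← le_inv_mul_iff₀ hcard]
  have hsum : ∑ _σ : Equiv.Perm (Fin n), g (nestedLoad E) ≤
      ∑ σ, ∫ ω, g ((A.policy ω).load (F σ)) ∂A.μ := by
    rw [← integral_finsetSum _ fun σ _ => hint σ]
    simpa using integral_mono (μ := A.μ) (integrable_const _)
      (integrable_finsetSum Finset.univ fun σ _ => hint σ) hpoint
  -- Derandomize the adversary: some fixed relabeling, depending on `A` but not on its coin flips,
  -- is at least as bad as the average.
  obtain ⟨σ, -, hσ⟩ := Finset.exists_le_of_sum_le Finset.univ_nonempty hsum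
  refine ⟨F σ, hF σ, ?_, le_trans ?_ hσ⟩
  · rintro _ ⟨l, hl, rfl⟩
    have hl' := feasibleLoads_subset_nestedSeq E hl
    exact ⟨l ∘ σ.symm, comp_symm_mem_feasibleLoads_relabel hl' σ,
      hsym σ.symm l (mem_orthant_of_mem_feasibleLoads hl')⟩
  -- A convex function on a hull is bounded by its value at some generator, and by symmetry all
  -- permutations of `w` have the same value.
  · obtain ⟨_, ⟨τ, rfl⟩, hτ⟩ := hg.exists_ge_of_mem_convexHull
      (by rintro _ ⟨τ, rfl⟩; exact comp_perm_mem_orthant (nestedLoad_mem_orthant E) τ)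
      (waterFilling_load_mem_convexHull E)
    exact hτ.trans_eq (hsym τ _ (nestedLoad_mem_orthant E))

theorem bddBelow_image_feasibleLoads (hsym : IsSymmetricOnOrthant g)
    (hg : ConvexOn ℝ (orthant n) g) (hq : 0 < q) {E : Fin m → Request n}
    (hE : E ∈ requestSeqs n m q) : BddBelow (g '' feasibleLoads E) := by
  obtain ⟨C, hC⟩ := exists_abs_le_of_convexOn hsym hg hq
  refine ⟨-C, ?_⟩
  rintro _ ⟨l, hl, rfl⟩
  exact (abs_le.1 (hC l (mem_orthant_of_mem_feasibleLoads hl)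
    (sum_eq_of_mem_feasibleLoads hE hl))).1

theorem minRegret_waterFilling_le (hsym : IsSymmetricOnOrthant g)
    (hg : ConvexOn ℝ (orthant n) g) (hq : 0 < q) {α : ℝ} (hα : 0 ≤ α)
    (A : RandomizedPolicy n) :
    minRegret n m q α g (waterFilling n).toRandomized ≤ minRegret n m q α g A := by
  refine iSup₂_le fun E hE => ?_
  obtain ⟨E', hE', hsub, hle⟩ := exists_adversarial_requestSeq hsym hg hq A hE
  refine le_iSup₂_of_le E' hE' (EReal.coe_le_coe_iff.2 ?_)
  have hinf : sInf (g '' feasibleLoads E') ≤ sInf (g '' feasibleLoads E) :=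
    csInf_le_csInf (bddBelow_image_feasibleLoads hsym hg hq hE')
      ⟨_, _, (waterFilling n).load_mem_feasibleLoads E, rfl⟩ hsub
  refine sub_le_sub ?_ (mul_le_mul_of_nonneg_left hinf hα)
  have hdet : ∫ ω, g (((waterFilling n).toRandomized.policy ω).load E)
      ∂(waterFilling n).toRandomized.μ = g ((waterFilling n).load E) := by
    change ∫ _, g ((waterFilling n).load E) ∂(waterFilling n).toRandomized.μ = _
    simp
  exact hdet.trans_le hle

theorem maxRegret_eq_minRegret_neg (α : ℝ) (f : (Fin n → ℝ) → ℝ) (A : RandomizedPolicy n) :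
    maxRegret n m q α f A = minRegret n m q α (-f) A := by
  have h : ∀ E : Fin m → Request n, maxCost α f A E = minCost α (-f) A E := fun E => by
    have himg : (-f) '' feasibleLoads E = -(f '' feasibleLoads E) := by
      rw [← Set.image_neg_eq_neg, Set.image_image]
      rfl
    rw [maxCost, minCost, himg, Real.sInf_neg]
    simp only [Pi.neg_apply, integral_neg]
    ring
  simp only [maxRegret, minRegret, h]

end Adversary

end OnlineAllocation

theorem mainTheorem3 (n m : ℕ) (q α : ℝ) (hq : 0 < q) (hα : 0 < α) :
    (∀ f : (Fin n → ℝ) → ℝ,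
      (∀ x ∈ OnlineAllocation.orthant n, 0 ≤ f x) →
      OnlineAllocation.IsSymmetricOnOrthant f →
      ConcaveOn ℝ (OnlineAllocation.orthant n) f →
      ∀ A : OnlineAllocation.RandomizedPolicy n,
        OnlineAllocation.maxRegret n m q α f (OnlineAllocation.waterFilling n).toRandomized ≤
          OnlineAllocation.maxRegret n m q α f A) ∧
    (∀ g : (Fin n → ℝ) → ℝ,
      (∀ x ∈ OnlineAllocation.orthant n, 0 ≤ g x) →
      OnlineAllocation.IsSymmetricOnOrthant g →
      ConvexOn ℝ (OnlineAllocation.orthant n) g →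
      ∀ A : OnlineAllocation.RandomizedPolicy n,
        OnlineAllocation.minRegret n m q α g (OnlineAllocation.waterFilling n).toRandomized ≤
          OnlineAllocation.minRegret n m q α g A) := by
  refine ⟨fun f _ hsym hf A => ?_, fun g _ hsym hg A =>
    OnlineAllocation.minRegret_waterFilling_le hsym hg hq hα.le A⟩
  rw [OnlineAllocation.maxRegret_eq_minRegret_neg, OnlineAllocation.maxRegret_eq_minRegret_neg]
  exact OnlineAllocation.minRegret_waterFilling_le
    (fun σ x hx => congrArg Neg.neg (hsym σ x hx)) hf.neg hq hα.le A
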